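/- Let $\Omega\subset\mathbb{R}^d$ be a convex set, and let $\mathcal M^+=\mathcal M^+(\Omega)$ be the set of finite nonnegative Radon measures on $\Omega$, with total mass $|\rho|:=\rho(\Omega)$. For $\rho_0,\rho_1\in\mathcal M^+$ define the following quantities in $[0,\infty]$ (the infimum of the empty set is $+\infty$). * If $|\rho_0|=|\rho_1|$, $$\mathtt{MK}^2(\rho_0,\rho_1)=\inf_{\gamma}\int_{\Omega\times\Omega}|x-y|^2\,\mathrm d\gamma(x,y),$$ where $\gamma$ ranges over the nonnegative measures on $\Omega\times\Omega$ with marginals $\rho_0$ and $\rho_1$. * $$\mathtt{FR}^2(\rho_0,\rho_1)=\inf_{(\rho,r)}\int_0^1\int_\Omega|r_t|^2\,\mathrm d\rho_t\,\mathrm dt,$$ where $(\rho,r)$ ranges over the narrowly continuous curves $[0,1]\ni t\mapsto\rho_t\in\mathcal M^+$ with endpoints $\rho_0,\rho_1$ and the fields $r\in L^2(0,1;L^2(\mathrm d\rho_t))$ such that $\partial_t\rho_t=\rho_tr_t$. * $$\mathtt{KFR}^2(\rho_0,\rho_1)=\inf_{(\rho,\mathbf v,r)}\int_0^1\int_\Omega\big(|\mathbf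 v_t|^2+|r_t|^2\big)\,\mathrm d\rho_t\,\mathrm dt,$$ where $(\rho,\mathbf v,r)$ ranges over the narrowly continuous curves $[0,1]\ni t\mapsto\rho_t\in\mathcal M^+$ with endpoints $\rho_0,\rho_1$ and the fields $\mathbf v\in L^2(0,1;L^2(\mathrm d\rho_t)^d)$, $r\in L^2(0,1;L^2(\mathrm d\rho_t))$ such that $\partial_t\rho_t+\operatorname{div}(\rho_t\mathbf v_t)=\rho_tr_t$. The equations are understood in the sense of distributions with no flux through $\partial\Omega$: for all $\varphi\in C_c^\infty((0,1)\times\mathbb{R}^d)$, $$\int_0^1\int_\Omega\big(\partial_t\varphi+\mathbf v_t\cdot\nabla\varphi+r_t\varphi\big)\,\mathrm d\rho_t\,\mathrm dt=0$$ (with $\mathbf v=0$ for $\mathtt{FR}$). **Proposition.** Let $\rho_0,\rho_1\in\mathcal M^+$ with $|\rho_1|>0$, and let $\tilde\rho_0:=\frac{|\rho_0|}{|\rho_1|}\rho_1$. Then $$\mathtt{KFR}^2(\rho_0,\rho_1)\le 2\big(\mathtt{MK}^2(\rho_0,\tilde\rho_0)+\mathtt{FR}^2(\tilde\rho_0,\rho_1)\big).$$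 -/

import Mathlib

open MeasureTheory Set
open scoped ENNReal NNReal ContDiff

noncomputable section

namespace KFRMetric

/-- The Euclidean space `ℝ^d`. -/
abbrev Eucl (d : ℕ) : Type := EuclideanSpace ℝ (Fin d)

/-- `ρ ∈ M⁺(Ω)`: a finite nonnegative Borel measure on `ℝ^d` (automatically Radon) that is
concentrated on `Ω`. -/
def OnDomain {d : ℕ} (Ω : Set (Eucl d)) (ρ : FiniteMeasure (Eucl d)) : Prop :=
  (ρ : Measure (Eucl d)) Ωᶜ = 0

/-- Narrowly continuous curves `[0,1] ∋ t ↦ ρ_t ∈ M⁺(Ω)` from `ρ₀` to `ρ₁`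
(the topology of `FiniteMeasure` is the narrow one, i.e. duality with bounded continuous
functions). Only the values at times in `[0,1]` matter. -/
structure IsNarrowCurve {d : ℕ} (Ω : Set (Eucl d)) (ρ₀ ρ₁ : FiniteMeasure (Eucl d))
    (ρ : ℝ → FiniteMeasure (Eucl d)) : Prop where
  continuousOn : ContinuousOn ρ (Icc 0 1)
  onDomain : ∀ t ∈ Icc (0 : ℝ) 1, OnDomain Ω (ρ t)
  source : ρ 0 = ρ₀
  target : ρ 1 = ρ₁

/-- Space-time test functions: smooth functions on `ℝ × ℝ^d` with compact support contained in
`(0,1) × ℝ^d`. They are tested against measures on `Ω`, so they need not vanish at the boundary of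
`Ω`: as usual for continuity equations on a domain, no mass flows through the boundary. -/
structure IsTestFunction {d : ℕ} (φ : ℝ × Eucl d → ℝ) : Prop where
  smooth : ContDiff ℝ ∞ φ
  compactSupport : HasCompactSupport φ
  support_subset : tsupport φ ⊆ Ioo (0 : ℝ) 1 ×ˢ univ

/-- `∂_t φ (t, x)`. -/
def timeDeriv {d : ℕ} (φ : ℝ × Eucl d → ℝ) (t : ℝ) (x : Eucl d) : ℝ :=
  deriv (fun s => φ (s, x)) t

/-- `∇_x φ (t, x)`. -/
def spaceGrad {d : ℕ} (φ : ℝ × Eucl d → ℝ) (t : ℝ) (x : Eucl d) : Eucl d :=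
  gradient (fun y => φ (t, y)) x

/-- The action `∫₀¹ ∫ (|v_t|² + |r_t|²) dρ_t dt`. -/
def kfrAction {d : ℕ} (ρ : ℝ → FiniteMeasure (Eucl d)) (v : ℝ → Eucl d → Eucl d)
    (r : ℝ → Eucl d → ℝ) : ℝ≥0∞ :=
  ∫⁻ t in Ioo (0 : ℝ) 1, ∫⁻ x, (‖v t x‖ₑ ^ 2 + ‖r t x‖ₑ ^ 2) ∂(ρ t : Measure (Eucl d))

/-- Admissible paths for the Kantorovich-Fisher-Rao distance: narrowly continuous curves with
velocity and reaction in `L²(0,1; L²(dρ_t))` that solve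
`∂_t ρ_t + div (ρ_t v_t) = ρ_t r_t` in the distributional sense. -/
structure KFRAdmissible {d : ℕ} (Ω : Set (Eucl d)) (ρ₀ ρ₁ : FiniteMeasure (Eucl d))
    (ρ : ℝ → FiniteMeasure (Eucl d)) (v : ℝ → Eucl d → Eucl d) (r : ℝ → Eucl d → ℝ) : Prop where
  curve : IsNarrowCurve Ω ρ₀ ρ₁ ρ
  measurable_velocity : Measurable (Function.uncurry v)
  measurable_reaction : Measurable (Function.uncurry r)
  finite_action : kfrAction ρ v r < ⊤
  equation : ∀ φ : ℝ × Eucl d → ℝ, IsTestFunction φ →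
    ∫ t in Ioo (0 : ℝ) 1, ∫ x,
      (timeDeriv φ t x + inner ℝ (v t x) (spaceGrad φ t x) + r t x * φ (t, x))
        ∂(ρ t : Measure (Eucl d)) = 0

/-- The squared Kantorovich-Fisher-Rao distance on `M⁺(Ω)`. -/
def KFRsq {d : ℕ} (Ω : Set (Eucl d)) (ρ₀ ρ₁ : FiniteMeasure (Eucl d)) : ℝ≥0∞ :=
  ⨅ (ρ : ℝ → FiniteMeasure (Eucl d)) (v : ℝ → Eucl d → Eucl d) (r : ℝ → Eucl d → ℝ)
    (_ : KFRAdmissible Ω ρ₀ ρ₁ ρ v r), kfrAction ρ v r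

/-- The action `∫₀¹ ∫ |r_t|² dρ_t dt`. -/
def frAction {d : ℕ} (ρ : ℝ → FiniteMeasure (Eucl d)) (r : ℝ → Eucl d → ℝ) : ℝ≥0∞ :=
  ∫⁻ t in Ioo (0 : ℝ) 1, ∫⁻ x, ‖r t x‖ₑ ^ 2 ∂(ρ t : Measure (Eucl d))

/-- Admissible paths for the Fisher-Rao distance: narrowly continuous curves with reaction in
`L²(0,1; L²(dρ_t))` that solve `∂_t ρ_t = ρ_t r_t` in the distributional sense. -/
structure FRAdmissible {d : ℕ} (Ω : Set (Eucl d)) (ρ₀ ρ₁ : FiniteMeasure (Eucl d))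
    (ρ : ℝ → FiniteMeasure (Eucl d)) (r : ℝ → Eucl d → ℝ) : Prop where
  curve : IsNarrowCurve Ω ρ₀ ρ₁ ρ
  measurable_reaction : Measurable (Function.uncurry r)
  finite_action : frAction ρ r < ⊤
  equation : ∀ φ : ℝ × Eucl d → ℝ, IsTestFunction φ →
    ∫ t in Ioo (0 : ℝ) 1, ∫ x, (timeDeriv φ t x + r t x * φ (t, x))
      ∂(ρ t : Measure (Eucl d)) = 0

/-- The squared Fisher-Rao distance on `M⁺(Ω)`. -/
def FRsq {d : ℕ} (Ω : Set (Eucl d)) (ρ₀ ρ₁ : FiniteMeasure (Eucl d)) : ℝ≥0∞ :=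
  ⨅ (ρ : ℝ → FiniteMeasure (Eucl d)) (r : ℝ → Eucl d → ℝ)
    (_ : FRAdmissible Ω ρ₀ ρ₁ ρ r), frAction ρ r

/-- Transference plans `γ` with marginals `ρ₀` and `ρ₁`. If both marginals are concentrated on `Ω`,
then `γ` is automatically concentrated on `Ω × Ω`. -/
structure IsTransferencePlan {d : ℕ} (ρ₀ ρ₁ : FiniteMeasure (Eucl d))
    (γ : Measure (Eucl d × Eucl d)) : Prop where
  fst_marginal : γ.map Prod.fst = (ρ₀ : Measure (Eucl d))
  snd_marginal : γ.map Prod.snd = (ρ₁ : Measure (Eucl d))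

/-- The squared quadratic Monge-Kantorovich distance, with values in `[0,∞]`. -/
def MKsq {d : ℕ} (ρ₀ ρ₁ : FiniteMeasure (Eucl d)) : ℝ≥0∞ :=
  ⨅ (γ : Measure (Eucl d × Eucl d)) (_ : IsTransferencePlan ρ₀ ρ₁ γ),
    ∫⁻ p, ‖p.1 - p.2‖ₑ ^ 2 ∂γ

/-- `(|ρ₀| / |ρ₁|) ρ₁`: the measure `ρ₁` rescaled to the mass of `ρ₀`. -/
def rescaled {d : ℕ} (ρ₀ ρ₁ : FiniteMeasure (Eucl d)) : FiniteMeasure (Eucl d) :=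
  (ρ₀.mass / ρ₁.mass) • ρ₁

end KFRMetric

end

namespace KFRMetric

open Filter Topology

section MeasureCurves

variable {X : Type*} [PseudoEMetricSpace X] [MeasurableSpace X] [BorelSpace X]

/-- A finite measure concentrated on a set is concentrated on a `σ`-compact subset of it. -/
theorem exists_isSigmaCompact_subset_measure_compl_eq_zero [T2Space X] {μ : Measure X}
    [IsFiniteMeasure μ] [μ.InnerRegularCompactLTTop] {s : Set X} (hs : μ sᶜ = 0) :
    ∃ K ⊆ s, IsSigmaCompact K ∧ μ Kᶜ = 0 := by
  set A := (toMeasurable μ sᶜ)ᶜ with hA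
  have hAm : MeasurableSet A := (measurableSet_toMeasurable _ _).compl
  have hA0 : μ Aᶜ = 0 := by simp [hA, measure_toMeasurable, hs]
  have hAs : A ⊆ s := compl_subset_comm.1 (subset_toMeasurable μ sᶜ)
  obtain ⟨ε, -, hεpos, hεlim⟩ := exists_seq_strictAnti_tendsto' (zero_lt_one (α := ℝ≥0∞))
  have hex : ∀ n, ∃ K ⊆ A, IsCompact K ∧ μ (A \ K) < ε n := fun n ↦
    hAm.exists_isCompact_sdiff_lt (measure_ne_top _ _) (hεpos n).1.ne'
  choose K hKA hKc hKε using hex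
  refine ⟨⋃ n, K n, (iUnion_subset hKA).trans hAs,
    isSigmaCompact_iUnion_of_isCompact _ hKc, ?_⟩
  have hdiff : μ (A \ ⋃ n, K n) = 0 := by
    refine nonpos_iff_eq_zero.1 (ge_of_tendsto' hεlim fun n ↦ ?_)
    exact (measure_mono (sdiff_subset_sdiff_right (subset_iUnion K n))).trans (hKε n).le
  refine measure_mono_null (fun x hx ↦ ?_) (measure_union_null hA0 hdiff)
  by_cases hxA : x ∈ A
  · exact Or.inr ⟨hxA, hx⟩
  · exact Or.inl hxA

/-- A narrowly continuous family of finite measures is a measurable family of measures. -/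
theorem measurable_toMeasure_of_continuous {T : Type*} [TopologicalSpace T] [MeasurableSpace T]
    [OpensMeasurableSpace T] {ρ : T → FiniteMeasure X} (hρ : Continuous ρ) :
    Measurable fun t ↦ (ρ t : Measure X) := by
  have hclosed : ∀ F : Set X, IsClosed F → Measurable fun t ↦ (ρ t : Measure X) F := by
    intro F hF
    refine measurable_of_tendsto_metrizable (f := fun n t ↦
      ∫⁻ x, hF.apprSeq n x ∂(ρ t : Measure X)) (fun n ↦ ?_) ?_
    · exact ((FiniteMeasure.continuous_lintegral_boundedContinuousFunction _).comp hρ).measurable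
    · exact tendsto_pi_nhds.2 fun t ↦ HasOuterApproxClosed.tendsto_lintegral_apprSeq hF _
  refine Measurable.measure_of_isPiSystem (S := {s : Set X | IsClosed s})
    (by rw [← borel_eq_generateFrom_isClosed]; exact BorelSpace.measurable_eq)
    isPiSystem_isClosed hclosed (hclosed _ isClosed_univ)

/-- Integrals of a continuous curve of bounded functions along a narrowly continuous curve of
measures are continuous. -/
theorem continuousOn_integral_of_continuousOn {T : Type*} [TopologicalSpace T] {s : Set T}
    {ρ : T → FiniteMeasure X} (hρ : ContinuousOn ρ s)
    {F : T → BoundedContinuousFunction X ℝ} (hF : ContinuousOn F s) :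
    ContinuousOn (fun t ↦ ∫ x, F t x ∂(ρ t : Measure X)) s := by
  intro t₀ ht₀
  have hmass : Tendsto (fun t ↦ ((ρ t).mass : ℝ)) (𝓝[s] t₀) (𝓝 ((ρ t₀).mass : ℝ)) :=
    (NNReal.continuous_coe.tendsto _).comp
      ((FiniteMeasure.continuous_mass.tendsto _).comp (hρ t₀ ht₀))
  have hnorm : Tendsto (fun t ↦ ‖F t - F t₀‖) (𝓝[s] t₀) (𝓝 0) :=
    tendsto_iff_norm_sub_tendsto_zero.1 (hF t₀ ht₀)
  have hdiff : Tendsto (fun t ↦ ∫ x, (F t - F t₀) x ∂(ρ t : Measure X)) (𝓝[s] t₀) (𝓝 0) := by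
    refine squeeze_zero_norm (fun t ↦ ?_) (by simpa using hnorm.mul hmass)
    refine (norm_integral_le_of_norm_le_const
      (Eventually.of_forall fun x ↦ (F t - F t₀).norm_coe_le_norm x)).trans (le_of_eq ?_)
    rfl
  have hconst := (FiniteMeasure.tendsto_iff_forall_integral_tendsto.1 (hρ t₀ ht₀)) (F t₀)
  have hsum := hdiff.add hconst
  rw [zero_add] at hsum
  refine hsum.congr fun t ↦ ?_
  rw [← integral_add ((F t - F t₀).integrable _) ((F t₀).integrable _)]
  simp

theorem continuousOn_integral_of_hasCompactSupport {X : Type*} [PseudoMetricSpace X]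
    [MeasurableSpace X] [BorelSpace X] {s : Set ℝ} {ρ : ℝ → FiniteMeasure X}
    (hρ : ContinuousOn ρ s) {f : ℝ × X → ℝ} (hf : Continuous f) (hc : HasCompactSupport f) :
    ContinuousOn (fun t ↦ ∫ x, f (t, x) ∂(ρ t : Measure X)) s := by
  obtain ⟨C, hC⟩ := hf.bounded_above_of_compact_support hc
  let F : ℝ → BoundedContinuousFunction X ℝ := fun t ↦
    BoundedContinuousFunction.ofNormedAddCommGroup (fun x ↦ f (t, x)) (by fun_prop) C
      fun x ↦ hC (t, x)
  have hF : Continuous F := by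
    have huc := hc.uniformContinuous_of_continuous hf
    rw [Metric.continuous_iff]
    intro t ε hε
    obtain ⟨δ, hδ, h⟩ := Metric.uniformContinuous_iff.1 huc (ε / 2) (half_pos hε)
    refine ⟨δ, hδ, fun t' ht' ↦ lt_of_le_of_lt
      ((BoundedContinuousFunction.dist_le (half_pos hε).le).2 fun x ↦ ?_) (half_lt_self hε)⟩
    exact (h (a := (t', x)) (b := (t, x)) (by simpa [Prod.dist_eq] using ht')).le
  exact continuousOn_integral_of_continuousOn hρ hF.continuousOn

end MeasureCurves

section OneDimensional

open Real (smoothTransition)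

theorem deriv_smoothTransition_eq_zero {x : ℝ} (hx : x < 0 ∨ 1 < x) :
    deriv smoothTransition x = 0 := by
  rcases hx with hx | hx
  · have : smoothTransition =ᶠ[𝓝 x] fun _ ↦ 0 := by
      filter_upwards [Iio_mem_nhds hx] with y hy
      exact Real.smoothTransition.zero_of_nonpos (le_of_lt hy)
    rw [this.deriv_eq, deriv_const]
  · have : smoothTransition =ᶠ[𝓝 x] fun _ ↦ 1 := by
      filter_upwards [Ioi_mem_nhds hx] with y hy
      exact Real.smoothTransition.one_of_one_le (le_of_lt hy)
    rw [this.deriv_eq, deriv_const]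

theorem hasDerivAt_smoothTransition_affine (a b c t : ℝ) :
    HasDerivAt (fun t ↦ smoothTransition (a * (t - b) + c))
      (deriv smoothTransition (a * (t - b) + c) * a) t := by
  have h1 : HasDerivAt smoothTransition (deriv smoothTransition (a * (t - b) + c))
      (a * (t - b) + c) :=
    ((Real.smoothTransition.contDiff (n := 1)).differentiable one_ne_zero _).hasDerivAt
  have h2 : HasDerivAt (fun t ↦ a * (t - b) + c) a t := by
    simpa using (((hasDerivAt_id t).sub_const b).const_mul a).add_const c
  exact h1.comp t h2

theorem continuous_deriv_smoothTransition : Continuous (deriv smoothTransition) :=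
  (Real.smoothTransition.contDiff (n := 1)).continuous_deriv le_rfl

/-- Derivatives of smooth steps concentrating at a point of `[0, 1]` are an approximate
identity. -/
theorem tendsto_integral_deriv_smoothTransition_mul {G : ℝ → ℝ} (hG : ContinuousOn G (Icc 0 1))
    {b : ℝ} (hb : b ∈ Icc (0 : ℝ) 1) (c : ℝ)
    (hstep : ∀ᶠ n : ℕ in atTop,
      smoothTransition (n * (1 - b) + c) - smoothTransition (n * (0 - b) + c) = 1) :
    Tendsto (fun n : ℕ ↦ ∫ t in Ioo (0 : ℝ) 1,
      deriv smoothTransition (n * (t - b) + c) * n * G t) atTop (𝓝 (G b)) := by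
  simp_rw [← integral_Icc_eq_integral_Ioo]
  refine tendsto_setIntegral_peak_smul_of_integrableOn_of_tendsto measurableSet_Icc
    (t := Icc (0 : ℝ) 1) measurableSet_Icc subset_rfl self_mem_nhdsWithin (by simp) ?_ ?_ ?_ ?_
    hG.integrableOn_Icc (hG b hb)
  · exact Eventually.of_forall fun n t _ ↦
      mul_nonneg (Real.smoothTransition.monotone.deriv_nonneg) (Nat.cast_nonneg n)
  · intro u hu hbu
    obtain ⟨δ, hδ, hball⟩ := Metric.isOpen_iff.1 hu b hbu
    rw [Metric.tendstoUniformlyOn_iff]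
    intro ε hε
    have hev : ∀ᶠ n : ℕ in atTop, (|c| + 1) / δ < n :=
      tendsto_natCast_atTop_atTop.eventually (eventually_gt_atTop _)
    filter_upwards [hev] with n hn t ht
    have htδ : δ ≤ |t - b| := by
      by_contra! hlt
      exact ht.2 (hball (by simpa [Real.dist_eq] using hlt))
    have hlarge : |c| + 1 < n * |t - b| := by
      rw [div_lt_iff₀ hδ] at hn
      exact hn.trans_le (mul_le_mul_of_nonneg_left htδ (Nat.cast_nonneg n))
    have hzero : deriv smoothTransition (n * (t - b) + c) = 0 := by
      apply deriv_smoothTransition_eq_zero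
      rcases abs_cases c with ⟨h1, h2⟩ | ⟨h1, h2⟩ <;>
        rcases abs_cases (t - b) with ⟨h3, h4⟩ | ⟨h3, h4⟩ <;> rw [h1, h3] at hlarge
      · right; linarith
      · left; linarith
      · right; linarith
      · left; linarith
    simpa [hzero] using hε
  · refine tendsto_const_nhds.congr' ?_
    filter_upwards [hstep] with n hn
    rw [integral_Icc_eq_integral_Ioc, ← intervalIntegral.integral_of_le zero_le_one,
      intervalIntegral.integral_eq_sub_of_hasDerivAt
        (fun t _ ↦ hasDerivAt_smoothTransition_affine n b c t), hn]
    refine Continuous.intervalIntegrable ?_ _ _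
    have := continuous_deriv_smoothTransition
    fun_prop
  · refine Eventually.of_forall fun n ↦ Continuous.aestronglyMeasurable ?_
    have := continuous_deriv_smoothTransition
    fun_prop

/-- A smooth cut-off of the interval `(0, 1)`, equal to `1` on `[2 / n, 1 - 2 / n]`. -/
noncomputable def timeCutoff (n : ℕ) (t : ℝ) : ℝ :=
  smoothTransition (n * (t - 0) + -1) - smoothTransition (n * (t - 1) + 2)

theorem contDiff_timeCutoff (n : ℕ) : ContDiff ℝ ∞ (timeCutoff n) := by
  unfold timeCutoff
  exact (Real.smoothTransition.contDiff.comp (by fun_prop)).sub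
    (Real.smoothTransition.contDiff.comp (by fun_prop))

theorem deriv_timeCutoff (n : ℕ) (t : ℝ) :
    deriv (timeCutoff n) t = deriv smoothTransition (n * (t - 0) + -1) * n -
      deriv smoothTransition (n * (t - 1) + 2) * n :=
  ((hasDerivAt_smoothTransition_affine n 0 (-1) t).sub
    (hasDerivAt_smoothTransition_affine n 1 2 t)).deriv

theorem tsupport_timeCutoff_subset {n : ℕ} (hn : 3 ≤ n) :
    tsupport (timeCutoff n) ⊆ Ioo 0 1 := by
  have hn' : (3 : ℝ) ≤ n := by exact_mod_cast hn
  have hsub : tsupport (timeCutoff n) ⊆ Icc (1 / n : ℝ) (1 - 1 / n) := by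
    refine closure_minimal (fun t ht ↦ ?_) isClosed_Icc
    by_contra hcon
    refine ht ?_
    unfold timeCutoff
    have hinv : (n : ℝ) * (1 / n) = 1 := by field_simp
    rw [mem_Icc, not_and_or, not_le, not_le] at hcon
    rcases hcon with h | h
    · have : (n : ℝ) * t < 1 := by
        rw [← hinv]; exact mul_lt_mul_of_pos_left h (by linarith)
      rw [Real.smoothTransition.zero_of_nonpos, Real.smoothTransition.zero_of_nonpos, sub_zero] <;>
        linarith
    · have : (n : ℝ) * (1 - 1 / n) < n * t := mul_lt_mul_of_pos_left h (by linarith)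
      rw [mul_sub, hinv] at this
      rw [Real.smoothTransition.one_of_one_le, Real.smoothTransition.one_of_one_le, sub_self] <;>
        linarith
  have hpos : (0 : ℝ) < 1 / n := by positivity
  exact hsub.trans fun t ht ↦ ⟨hpos.trans_le ht.1, ht.2.trans_lt (by linarith)⟩

theorem abs_timeCutoff_le_one (n : ℕ) (t : ℝ) : |timeCutoff n t| ≤ 1 := by
  unfold timeCutoff
  rw [abs_le]
  constructor <;>
    linarith [Real.smoothTransition.nonneg (n * (t - 0) + -1),
      Real.smoothTransition.nonneg (n * (t - 1) + 2),
      Real.smoothTransition.le_one (n * (t - 0) + -1),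
      Real.smoothTransition.le_one (n * (t - 1) + 2)]

theorem tendsto_timeCutoff {t : ℝ} (ht : t ∈ Ioo (0 : ℝ) 1) :
    Tendsto (fun n ↦ timeCutoff n t) atTop (𝓝 1) := by
  refine tendsto_const_nhds.congr' ?_
  have h1 : ∀ᶠ n : ℕ in atTop, 2 / t < n :=
    tendsto_natCast_atTop_atTop.eventually (eventually_gt_atTop _)
  have h2 : ∀ᶠ n : ℕ in atTop, 2 / (1 - t) < n :=
    tendsto_natCast_atTop_atTop.eventually (eventually_gt_atTop _)
  filter_upwards [h1, h2] with n hn1 hn2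
  rw [div_lt_iff₀ ht.1] at hn1
  rw [div_lt_iff₀ (sub_pos.2 ht.2)] at hn2
  unfold timeCutoff
  rw [Real.smoothTransition.one_of_one_le (by linarith),
    Real.smoothTransition.zero_of_nonpos (by linarith), sub_zero]

/-- If `G' = H` on `(0, 1)` in the sense of distributions and `G` is continuous on `[0, 1]`, then
the integral of `H` is the increment of `G`. -/
theorem integral_eq_sub_of_weak_deriv {G H : ℝ → ℝ} (hG : ContinuousOn G (Icc 0 1))
    (hH : IntegrableOn H (Ioo 0 1))
    (hweak : ∀ η : ℝ → ℝ, ContDiff ℝ ∞ η → tsupport η ⊆ Ioo 0 1 →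
      ∫ t in Ioo (0 : ℝ) 1, (deriv η t * G t + η t * H t) = 0) :
    ∫ t in Ioo (0 : ℝ) 1, H t = G 1 - G 0 := by
  have hleft := tendsto_integral_deriv_smoothTransition_mul hG
    (left_mem_Icc.2 zero_le_one) (-1) (by
      filter_upwards [eventually_ge_atTop 2] with n hn
      have hn' : (2 : ℝ) ≤ n := by exact_mod_cast hn
      rw [Real.smoothTransition.one_of_one_le (by linarith),
        Real.smoothTransition.zero_of_nonpos (by linarith), sub_zero])
  have hright := tendsto_integral_deriv_smoothTransition_mul hG
    (right_mem_Icc.2 zero_le_one) 2 (by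
      filter_upwards [eventually_ge_atTop 2] with n hn
      have hn' : (2 : ℝ) ≤ n := by exact_mod_cast hn
      rw [Real.smoothTransition.one_of_one_le (by linarith),
        Real.smoothTransition.zero_of_nonpos (by linarith), sub_zero])
  have hmain : Tendsto (fun n ↦ ∫ t in Ioo (0 : ℝ) 1, timeCutoff n t * H t) atTop
      (𝓝 (∫ t in Ioo (0 : ℝ) 1, H t)) := by
    refine tendsto_integral_of_dominated_convergence (fun t ↦ ‖H t‖) (fun n ↦ ?_) hH.norm
      (fun n ↦ Eventually.of_forall fun t ↦ ?_) ?_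
    · exact (contDiff_timeCutoff n).continuous.aestronglyMeasurable.mul hH.aestronglyMeasurable
    · rw [norm_mul]
      exact mul_le_of_le_one_left (norm_nonneg _) (abs_timeCutoff_le_one n t)
    · filter_upwards [ae_restrict_mem measurableSet_Ioo] with t ht
      simpa using (tendsto_timeCutoff ht).mul_const (H t)
  have hmulG : ∀ f : ℝ → ℝ, Continuous f → IntegrableOn (fun t ↦ f t * G t) (Ioo 0 1) :=
    fun f hf ↦ (hf.continuousOn.mul hG).integrableOn_Icc.mono_set Ioo_subset_Icc_self
  have hsum := (hleft.sub hright).add hmain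
  have hzero : ∀ᶠ n : ℕ in atTop,
      (∫ t in Ioo (0 : ℝ) 1, deriv smoothTransition (n * (t - 0) + -1) * n * G t) -
        (∫ t in Ioo (0 : ℝ) 1, deriv smoothTransition (n * (t - 1) + 2) * n * G t) +
        ∫ t in Ioo (0 : ℝ) 1, timeCutoff n t * H t = 0 := by
    filter_upwards [eventually_ge_atTop 3] with n hn
    have hc := continuous_deriv_smoothTransition
    have hint0 := hmulG (fun t ↦ deriv smoothTransition (n * (t - 0) + -1) * n) (by fun_prop)
    have hint1 := hmulG (fun t ↦ deriv smoothTransition (n * (t - 1) + 2) * n) (by fun_prop)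
    refine Eq.trans ?_ (hweak _ (contDiff_timeCutoff n) (tsupport_timeCutoff_subset hn))
    rw [← integral_sub hint0 hint1]
    refine (integral_add (hint0.sub hint1) ?_).symm.trans ?_; rotate_left
    · refine integral_congr_ae (Eventually.of_forall fun t ↦ ?_)
      simp only [deriv_timeCutoff, Pi.sub_apply]
      ring
    · exact hH.bdd_mul (c := 1) (contDiff_timeCutoff n).continuous.aestronglyMeasurable
        (Eventually.of_forall fun t ↦ abs_timeCutoff_le_one n t)
  have := tendsto_nhds_unique (hsum.congr' hzero) tendsto_const_nhds
  linarith

end OneDimensional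

theorem integrable_inner_of_memLp {α E : Type*} [MeasurableSpace α] [NormedAddCommGroup E]
    [InnerProductSpace ℝ E] {μ : Measure α} {f g : α → E} (hf : MemLp f 2 μ) (hg : MemLp g 2 μ) :
    Integrable (fun a ↦ inner ℝ (f a) (g a)) μ :=
  (hf.norm.integrable_mul hg.norm).mono'
    (hf.aestronglyMeasurable.inner hg.aestronglyMeasurable)
    (Eventually.of_forall fun _ ↦ norm_inner_le_norm _ _)

section TestFunctions

variable {d : ℕ} {φ : ℝ × Eucl d → ℝ}

theorem timeDeriv_eq_fderiv (hφ : Differentiable ℝ φ) (t : ℝ) (x : Eucl d) :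
    timeDeriv φ t x = fderiv ℝ φ (t, x) (1, 0) := by
  have h := (hφ (t, x)).hasFDerivAt.comp_hasDerivAt t
    ((hasDerivAt_id t).prodMk (hasDerivAt_const t x))
  exact h.deriv

theorem hasGradientAt_spaceGrad (hφ : Differentiable ℝ φ) (t : ℝ) (x : Eucl d) :
    HasGradientAt (fun y ↦ φ (t, y)) (spaceGrad φ t x) x :=
  DifferentiableAt.hasGradientAt
    ((hφ (t, x)).comp x ((differentiableAt_const t).prodMk differentiableAt_id))

theorem spaceGrad_eq_fderiv (hφ : Differentiable ℝ φ) (t : ℝ) (x : Eucl d) :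
    spaceGrad φ t x = (InnerProductSpace.toDual ℝ (Eucl d)).symm
      ((fderiv ℝ φ (t, x)).comp (ContinuousLinearMap.inr ℝ ℝ (Eucl d))) := by
  have h : HasFDerivAt (fun y ↦ φ (t, y))
      ((fderiv ℝ φ (t, x)).comp (ContinuousLinearMap.inr ℝ ℝ (Eucl d))) x :=
    (hφ (t, x)).hasFDerivAt.comp x (hasFDerivAt_prodMk_right t x)
  exact h.hasGradientAt.gradient

theorem inner_spaceGrad (hφ : Differentiable ℝ φ) (t : ℝ) (x u : Eucl d) :
    inner ℝ u (spaceGrad φ t x) = fderiv ℝ φ (t, x) (0, u) := by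
  rw [real_inner_comm, spaceGrad_eq_fderiv hφ, InnerProductSpace.toDual_symm_apply]
  rfl

theorem continuous_timeDeriv (hφ : ContDiff ℝ ∞ φ) :
    Continuous fun p : ℝ × Eucl d ↦ timeDeriv φ p.1 p.2 := by
  have hd := hφ.differentiable (by simp)
  simp_rw [timeDeriv_eq_fderiv hd]
  exact (hφ.continuous_fderiv (by simp)).clm_apply continuous_const

theorem continuous_spaceGrad (hφ : ContDiff ℝ ∞ φ) :
    Continuous fun p : ℝ × Eucl d ↦ spaceGrad φ p.1 p.2 := by
  have hd := hφ.differentiable (by simp)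
  simp_rw [spaceGrad_eq_fderiv hd]
  exact (LinearIsometryEquiv.continuous _).comp
    ((hφ.continuous_fderiv (by simp)).clm_comp continuous_const)

theorem hasCompactSupport_timeDeriv (hφ : ContDiff ℝ ∞ φ) (hc : HasCompactSupport φ) :
    HasCompactSupport fun p : ℝ × Eucl d ↦ timeDeriv φ p.1 p.2 := by
  have hd := hφ.differentiable (by simp)
  simp_rw [timeDeriv_eq_fderiv hd]
  exact (hc.fderiv ℝ).comp_left (g := fun L : ℝ × Eucl d →L[ℝ] ℝ ↦ L (1, 0)) rfl

theorem hasCompactSupport_spaceGrad (hφ : ContDiff ℝ ∞ φ) (hc : HasCompactSupport φ) :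
    HasCompactSupport fun p : ℝ × Eucl d ↦ spaceGrad φ p.1 p.2 := by
  have hd := hφ.differentiable (by simp)
  simp_rw [spaceGrad_eq_fderiv hd]
  exact (hc.fderiv ℝ).comp_left (g := fun L : ℝ × Eucl d →L[ℝ] ℝ ↦
    (InnerProductSpace.toDual ℝ (Eucl d)).symm
      (L.comp (ContinuousLinearMap.inr ℝ ℝ (Eucl d)))) (by simp)

theorem timeDeriv_mul_time (hφ : Differentiable ℝ φ) {η : ℝ → ℝ} (hη : Differentiable ℝ η)
    (t : ℝ) (x : Eucl d) :
    timeDeriv (fun p ↦ η p.1 * φ p) t x = deriv η t * φ (t, x) + η t * timeDeriv φ t x := by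
  have h : DifferentiableAt ℝ (fun s ↦ φ (s, x)) t :=
    (hφ (t, x)).comp t (differentiableAt_id.prodMk (differentiableAt_const x))
  exact deriv_mul (hη t) h

theorem spaceGrad_mul_time (hφ : Differentiable ℝ φ) (η : ℝ → ℝ) (t : ℝ) (x : Eucl d) :
    spaceGrad (fun p ↦ η p.1 * φ p) t x = η t • spaceGrad φ t x := by
  have h := ((hasGradientAt_spaceGrad hφ t x).hasFDerivAt.const_mul (η t)).hasGradientAt.gradient
  rwa [map_smul, LinearIsometryEquiv.symm_apply_apply] at h

theorem isTestFunction_mul_time (hφ : ContDiff ℝ ∞ φ) (hc : HasCompactSupport φ) {η : ℝ → ℝ}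
    (hη : ContDiff ℝ ∞ η) (hsupp : tsupport η ⊆ Ioo 0 1) :
    IsTestFunction fun p : ℝ × Eucl d ↦ η p.1 * φ p where
  smooth := (hη.comp contDiff_fst).mul hφ
  compactSupport := hc.mul_left
  support_subset := by
    rw [prod_univ]
    refine (tsupport_mul_subset_left (f := fun p : ℝ × Eucl d ↦ η p.1)).trans ?_
    exact (tsupport_comp_subset_preimage η continuous_fst).trans (preimage_mono hsupp)

end TestFunctions

section Paths

variable {d : ℕ} {Ω : Set (Eucl d)} {ρ₀ ρ₁ : FiniteMeasure (Eucl d)}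
  {ρ : ℝ → FiniteMeasure (Eucl d)} {v : ℝ → Eucl d → Eucl d} {r : ℝ → Eucl d → ℝ}

open ProbabilityTheory

/-- A narrowly continuous curve on `[0, 1]` as a kernel, extended by constants. -/
noncomputable def curveKernel (hρ : ContinuousOn ρ (Icc 0 1)) : Kernel ℝ (Eucl d) where
  toFun t := ρ (projIcc 0 1 zero_le_one t)
  measurable' := measurable_toMeasure_of_continuous
    (hρ.domRestrict.comp (continuous_projIcc (h := zero_le_one)))

theorem curveKernel_apply (hρ : ContinuousOn ρ (Icc 0 1)) {t : ℝ} (ht : t ∈ Icc (0 : ℝ) 1) :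
    curveKernel hρ t = ρ t := by
  change (ρ (projIcc 0 1 zero_le_one t) : Measure (Eucl d)) = ρ t
  rw [projIcc_of_mem _ ht]

instance (hρ : ContinuousOn ρ (Icc 0 1)) : IsFiniteKernel (curveKernel hρ) := by
  have hmass : ContinuousOn (fun t ↦ (ρ t).mass) (Icc 0 1) :=
    FiniteMeasure.continuous_mass.comp_continuousOn hρ
  obtain ⟨C, hC⟩ := isCompact_Icc.bddAbove_image hmass
  refine ⟨C, ENNReal.coe_lt_top, fun t ↦ ?_⟩
  change (ρ (projIcc 0 1 zero_le_one t) : Measure (Eucl d)) univ ≤ C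
  rw [← FiniteMeasure.ennreal_mass, ENNReal.coe_le_coe]
  exact hC (mem_image_of_mem _ (projIcc 0 1 zero_le_one t).2)

/-- The space-time measure `ρ_t dt` on `(0, 1) × ℝ^d`. -/
noncomputable def spaceTimeMeasure (hρ : ContinuousOn ρ (Icc 0 1)) : Measure (ℝ × Eucl d) :=
  (volume.restrict (Ioo 0 1)) ⊗ₘ curveKernel hρ

instance (hρ : ContinuousOn ρ (Icc 0 1)) : IsFiniteMeasure (spaceTimeMeasure hρ) := by
  unfold spaceTimeMeasure; infer_instance

theorem lintegral_spaceTimeMeasure (hρ : ContinuousOn ρ (Icc 0 1)) {f : ℝ × Eucl d → ℝ≥0∞}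
    (hf : Measurable f) :
    ∫⁻ p, f p ∂(spaceTimeMeasure hρ) =
      ∫⁻ t in Ioo (0 : ℝ) 1, ∫⁻ x, f (t, x) ∂(ρ t : Measure (Eucl d)) := by
  rw [spaceTimeMeasure, Measure.lintegral_compProd hf]
  refine setLIntegral_congr_fun measurableSet_Ioo fun t ht ↦ ?_
  simp only [curveKernel_apply hρ (Ioo_subset_Icc_self ht)]

theorem ae_integrable_of_spaceTimeMeasure (hρ : ContinuousOn ρ (Icc 0 1))
    {f : ℝ × Eucl d → ℝ} (hf : Integrable f (spaceTimeMeasure hρ)) :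
    ∀ᵐ t ∂(volume.restrict (Ioo (0 : ℝ) 1)),
      Integrable (fun x ↦ f (t, x)) (ρ t : Measure (Eucl d)) := by
  filter_upwards [((Measure.integrable_compProd_iff hf.aestronglyMeasurable).1 hf).1,
    ae_restrict_mem measurableSet_Ioo] with t h ht
  rwa [curveKernel_apply hρ (Ioo_subset_Icc_self ht)] at h

theorem integrableOn_integral_of_spaceTimeMeasure (hρ : ContinuousOn ρ (Icc 0 1))
    {f : ℝ × Eucl d → ℝ} (hf : Integrable f (spaceTimeMeasure hρ)) :
    IntegrableOn (fun t ↦ ∫ x, f (t, x) ∂(ρ t : Measure (Eucl d))) (Ioo 0 1) := by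
  have h : Integrable (fun t ↦ ∫ x, f (t, x) ∂(curveKernel hρ t))
      (volume.restrict (Ioo (0 : ℝ) 1)) := by
    simpa using Integrable.integral_compProd (κ := Kernel.const Unit (volume.restrict (Ioo 0 1)))
      (η := Kernel.prodMkLeft Unit (curveKernel hρ)) (a := ()) hf
  refine h.congr ?_
  filter_upwards [ae_restrict_mem measurableSet_Ioo] with t ht
  rw [curveKernel_apply hρ (Ioo_subset_Icc_self ht)]

namespace KFRAdmissible

theorem lintegral_spaceTimeMeasure_eq (h : KFRAdmissible Ω ρ₀ ρ₁ ρ v r) :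
    ∫⁻ p, (‖v p.1 p.2‖ₑ ^ 2 + ‖r p.1 p.2‖ₑ ^ 2) ∂(spaceTimeMeasure h.curve.continuousOn) =
      kfrAction ρ v r :=
  lintegral_spaceTimeMeasure _
    ((h.measurable_velocity.enorm.pow_const 2).add (h.measurable_reaction.enorm.pow_const 2))

theorem memLp_velocity (h : KFRAdmissible Ω ρ₀ ρ₁ ρ v r) :
    MemLp (Function.uncurry v) 2 (spaceTimeMeasure h.curve.continuousOn) := by
  refine ⟨h.measurable_velocity.aestronglyMeasurable, ?_⟩
  rw [eLpNorm_lt_top_iff_lintegral_rpow_enorm_lt_top (by simp) (by simp)]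
  refine lt_of_le_of_lt (lintegral_mono fun p ↦ ?_)
    (h.lintegral_spaceTimeMeasure_eq.trans_lt h.finite_action)
  simp [Function.uncurry]

theorem memLp_reaction (h : KFRAdmissible Ω ρ₀ ρ₁ ρ v r) :
    MemLp (Function.uncurry r) 2 (spaceTimeMeasure h.curve.continuousOn) := by
  refine ⟨h.measurable_reaction.aestronglyMeasurable, ?_⟩
  rw [eLpNorm_lt_top_iff_lintegral_rpow_enorm_lt_top (by simp) (by simp)]
  refine lt_of_le_of_lt (lintegral_mono fun p ↦ ?_)
    (h.lintegral_spaceTimeMeasure_eq.trans_lt h.finite_action)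
  simp [Function.uncurry]

theorem integrable_integrand (h : KFRAdmissible Ω ρ₀ ρ₁ ρ v r) {φ : ℝ × Eucl d → ℝ}
    (hφ : ContDiff ℝ ∞ φ) (hc : HasCompactSupport φ) :
    Integrable (fun p : ℝ × Eucl d ↦ timeDeriv φ p.1 p.2 +
      inner ℝ (v p.1 p.2) (spaceGrad φ p.1 p.2) + r p.1 p.2 * φ (p.1, p.2))
      (spaceTimeMeasure h.curve.continuousOn) := by
  refine Integrable.add (Integrable.add ?_ ?_) ?_
  · exact (continuous_timeDeriv hφ).integrable_of_hasCompactSupport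
      (hasCompactSupport_timeDeriv hφ hc)
  · exact integrable_inner_of_memLp h.memLp_velocity
      ((continuous_spaceGrad hφ).memLp_of_hasCompactSupport (hasCompactSupport_spaceGrad hφ hc))
  · exact h.memLp_reaction.integrable_mul (q := 2)
      (hφ.continuous.memLp_of_hasCompactSupport hc)

/-- The weak formulation tested with functions that do not vanish at the endpoints. -/
theorem integral_eq_sub (h : KFRAdmissible Ω ρ₀ ρ₁ ρ v r) {φ : ℝ × Eucl d → ℝ}
    (hφ : ContDiff ℝ ∞ φ) (hc : HasCompactSupport φ) :
    ∫ t in Ioo (0 : ℝ) 1, ∫ x,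
      (timeDeriv φ t x + inner ℝ (v t x) (spaceGrad φ t x) + r t x * φ (t, x))
        ∂(ρ t : Measure (Eucl d)) =
      ∫ x, φ (1, x) ∂(ρ₁ : Measure (Eucl d)) - ∫ x, φ (0, x) ∂(ρ₀ : Measure (Eucl d)) := by
  have hint := h.integrable_integrand hφ hc
  have hd := hφ.differentiable (by simp)
  rw [← h.curve.target, ← h.curve.source]
  refine integral_eq_sub_of_weak_deriv
    (G := fun t ↦ ∫ x, φ (t, x) ∂(ρ t : Measure (Eucl d)))
    (continuousOn_integral_of_hasCompactSupport h.curve.continuousOn hφ.continuous hc)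
    (integrableOn_integral_of_spaceTimeMeasure _ hint) fun η hη hsupp ↦ ?_
  refine Eq.trans ?_ (h.equation _ (isTestFunction_mul_time hφ hc hη hsupp))
  refine integral_congr_ae ?_
  have hφint : Integrable φ (spaceTimeMeasure h.curve.continuousOn) :=
    hφ.continuous.integrable_of_hasCompactSupport hc
  filter_upwards [ae_integrable_of_spaceTimeMeasure _ hint,
    ae_integrable_of_spaceTimeMeasure _ hφint] with t ht1 ht2
  rw [← integral_const_mul (deriv η t), ← integral_const_mul (η t),
    ← integral_add (ht2.const_mul _) (ht1.const_mul _)]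
  refine integral_congr_ae (Eventually.of_forall fun x ↦ ?_)
  simp only [timeDeriv_mul_time hd (hη.differentiable (by simp)), spaceGrad_mul_time hd,
    inner_smul_right]
  ring

end KFRAdmissible

end Paths

section Concatenation

theorem image_affine_Ioo_half (c : ℝ) :
    (fun t : ℝ ↦ 2 * t - c) '' Ioo (c / 2) ((c + 1) / 2) = Ioo 0 1 := by
  ext s
  constructor
  · rintro ⟨t, ⟨h1, h2⟩, rfl⟩
    constructor <;> simp only <;> linarith
  · rintro ⟨h1, h2⟩
    exact ⟨(s + c) / 2, ⟨by linarith, by linarith⟩, by simp only; ring⟩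

theorem hasDerivWithinAt_affine_half (c : ℝ) (s : Set ℝ) :
    ∀ t ∈ s, HasDerivWithinAt (fun t : ℝ ↦ 2 * t - c) 2 s t := fun t _ ↦ by
  simpa using (((hasDerivAt_id t).const_mul 2).sub_const c).hasDerivWithinAt (s := s)

theorem injOn_affine_half (c : ℝ) (s : Set ℝ) : InjOn (fun t : ℝ ↦ 2 * t - c) s :=
  fun _ _ _ _ h ↦ by simp only at h; linarith

theorem lintegral_affine_half (c : ℝ) (f : ℝ → ℝ≥0∞) :
    ∫⁻ t in Ioo (c / 2) ((c + 1) / 2), 2 * f (2 * t - c) = ∫⁻ s in Ioo 0 1, f s := by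
  rw [← image_affine_Ioo_half c, lintegral_image_eq_lintegral_abs_deriv_mul measurableSet_Ioo
    (hasDerivWithinAt_affine_half c _) (injOn_affine_half c _)]
  simp

theorem integral_affine_half (c : ℝ) (f : ℝ → ℝ) :
    ∫ t in Ioo (c / 2) ((c + 1) / 2), 2 * f (2 * t - c) = ∫ s in Ioo 0 1, f s := by
  rw [← image_affine_Ioo_half c, integral_image_eq_integral_abs_deriv_smul measurableSet_Ioo
    (hasDerivWithinAt_affine_half c _) (injOn_affine_half c _)]
  simp

theorem integrableOn_affine_half (c : ℝ) {f : ℝ → ℝ} (hf : IntegrableOn f (Ioo 0 1)) :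
    IntegrableOn (fun t ↦ 2 * f (2 * t - c)) (Ioo (c / 2) ((c + 1) / 2)) := by
  rw [← image_affine_Ioo_half c, integrableOn_image_iff_integrableOn_abs_deriv_smul
    measurableSet_Ioo (hasDerivWithinAt_affine_half c _) (injOn_affine_half c _)] at hf
  simpa using hf

theorem restrict_Ioo_eq_add_half :
    (volume.restrict (Ioo (0 : ℝ) 1)) =
      volume.restrict (Ioo ((0 : ℝ) / 2) ((0 + 1) / 2)) +
        volume.restrict (Ioo ((1 : ℝ) / 2) ((1 + 1) / 2)) := by
  rw [Measure.restrict_congr_set Ioo_ae_eq_Ioc, Measure.restrict_congr_set Ioo_ae_eq_Ioc,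
    Measure.restrict_congr_set Ioo_ae_eq_Ioc, ← Measure.restrict_union _ measurableSet_Ioc]
  · congr 1
    norm_num [Ioc_union_Ioc_eq_Ioc]
  · norm_num [Ioc_disjoint_Ioc]

variable {d : ℕ} {Ω : Set (Eucl d)} {ρ₀ ρ₁ ρ₂ : FiniteMeasure (Eucl d)}
  {ρ ρ' : ℝ → FiniteMeasure (Eucl d)} {v v' : ℝ → Eucl d → Eucl d} {r r' : ℝ → Eucl d → ℝ}

theorem timeDeriv_comp_affine {φ : ℝ × Eucl d → ℝ} (hφ : Differentiable ℝ φ) (a b t : ℝ)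
    (x : Eucl d) :
    timeDeriv (fun p ↦ φ (a * p.1 + b, p.2)) t x = a * timeDeriv φ (a * t + b) x := by
  have h : HasDerivAt (fun s ↦ φ (s, x)) (timeDeriv φ (a * t + b) x) (a * t + b) :=
    ((hφ (a * t + b, x)).comp (a * t + b)
      (differentiableAt_id.prodMk (differentiableAt_const x))).hasDerivAt
  have h2 : HasDerivAt (fun s ↦ a * s + b) a t := by
    simpa using ((hasDerivAt_id t).const_mul a).add_const b
  rw [mul_comm]
  exact (h.comp t h2).deriv

theorem lintegral_half_eq_two_mul_kfrAction (ρ : ℝ → FiniteMeasure (Eucl d))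
    (v : ℝ → Eucl d → Eucl d) (r : ℝ → Eucl d → ℝ) (c : ℝ) :
    ∫⁻ t in Ioo (c / 2) ((c + 1) / 2), ∫⁻ x, (‖(2 : ℝ) • v (2 * t - c) x‖ₑ ^ 2 +
      ‖2 * r (2 * t - c) x‖ₑ ^ 2) ∂(ρ (2 * t - c) : Measure (Eucl d)) = 2 * kfrAction ρ v r := by
  rw [kfrAction, ← lintegral_affine_half c, ← lintegral_const_mul' _ _ ENNReal.ofNat_ne_top]
  refine lintegral_congr fun t ↦ ?_
  rw [← lintegral_const_mul' _ _ ENNReal.ofNat_ne_top,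
    ← lintegral_const_mul' _ _ ENNReal.ofNat_ne_top]
  refine lintegral_congr fun x ↦ ?_
  have h2 : ‖(2 : ℝ)‖ₑ = 2 := by simp [Real.enorm_eq_ofReal]
  rw [enorm_smul, enorm_mul, h2]
  ring

namespace KFRAdmissible

theorem KFRsq_le (h : KFRAdmissible Ω ρ₀ ρ₁ ρ v r) : KFRsq Ω ρ₀ ρ₁ ≤ kfrAction ρ v r :=
  iInf_le_of_le ρ <| iInf_le_of_le v <| iInf_le_of_le r <| iInf_le _ h

theorem integral_half (h : KFRAdmissible Ω ρ₀ ρ₁ ρ v r) (c : ℝ) {φ : ℝ × Eucl d → ℝ}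
    (hφ : ContDiff ℝ ∞ φ) (hc : HasCompactSupport φ) :
    IntegrableOn (fun t ↦ ∫ x, (timeDeriv φ t x +
        inner ℝ ((2 : ℝ) • v (2 * t - c) x) (spaceGrad φ t x) + 2 * r (2 * t - c) x * φ (t, x))
        ∂(ρ (2 * t - c) : Measure (Eucl d))) (Ioo (c / 2) ((c + 1) / 2)) ∧
      ∫ t in Ioo (c / 2) ((c + 1) / 2), ∫ x, (timeDeriv φ t x +
        inner ℝ ((2 : ℝ) • v (2 * t - c) x) (spaceGrad φ t x) + 2 * r (2 * t - c) x * φ (t, x))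
        ∂(ρ (2 * t - c) : Measure (Eucl d)) =
      ∫ x, φ ((c + 1) / 2, x) ∂(ρ₁ : Measure (Eucl d)) -
        ∫ x, φ (c / 2, x) ∂(ρ₀ : Measure (Eucl d)) := by
  set ψ : ℝ × Eucl d → ℝ := fun p ↦ φ (2⁻¹ * p.1 + c / 2, p.2) with hψ
  have hd := hφ.differentiable (by simp)
  have hψ1 : ContDiff ℝ ∞ ψ := hφ.comp (by fun_prop)
  have hψ2 : HasCompactSupport ψ := hc.comp_homeomorph
    ((affineHomeomorph (2⁻¹ : ℝ) (c / 2) (by norm_num)).prodCongr (Homeomorph.refl (Eucl d)))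
  set H : ℝ → ℝ := fun s ↦ ∫ x, (timeDeriv ψ s x +
    inner ℝ (v s x) (spaceGrad ψ s x) + r s x * ψ (s, x)) ∂(ρ s : Measure (Eucl d)) with hH
  have key : (fun t ↦ ∫ x, (timeDeriv φ t x +
      inner ℝ ((2 : ℝ) • v (2 * t - c) x) (spaceGrad φ t x) + 2 * r (2 * t - c) x * φ (t, x))
      ∂(ρ (2 * t - c) : Measure (Eucl d))) = fun t ↦ 2 * H (2 * t - c) := by
    funext t
    rw [hH]
    beta_reduce
    rw [← integral_const_mul]
    refine integral_congr_ae (Eventually.of_forall fun x ↦ ?_)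
    have ht : 2⁻¹ * (2 * t - c) + c / 2 = t := by ring
    have hgrad : spaceGrad ψ (2 * t - c) x = spaceGrad φ t x := by
      simp only [spaceGrad, hψ, ht]
    simp only [hgrad]
    simp only [hψ, timeDeriv_comp_affine hd, ht, inner_smul_left]
    simp only [conj_trivial]
    ring
  have hint := integrableOn_integral_of_spaceTimeMeasure _ (h.integrable_integrand hψ1 hψ2)
  rw [key]
  refine ⟨integrableOn_affine_half c hint, ?_⟩
  refine (integral_affine_half c H).trans ?_
  rw [h.integral_eq_sub hψ1 hψ2]
  congr 2
  · funext x; simp only [hψ]; congr 2; ring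
  · funext x; simp only [hψ]; congr 2; ring

end KFRAdmissible

/-- Concatenation of two curves defined on `[0, 1]`, each run at double speed. -/
noncomputable def concat {α : Type*} (f g : ℝ → α) (t : ℝ) : α :=
  if t ≤ 1 / 2 then f (2 * t - 0) else g (2 * t - 1)

theorem concat_of_mem_left {α : Type*} (f g : ℝ → α) {t : ℝ}
    (ht : t ∈ Ioo ((0 : ℝ) / 2) ((0 + 1) / 2)) : concat f g t = f (2 * t - 0) :=
  if_pos (by linarith [ht.2])

theorem concat_of_mem_right {α : Type*} (f g : ℝ → α) {t : ℝ}
    (ht : t ∈ Ioo ((1 : ℝ) / 2) ((1 + 1) / 2)) : concat f g t = g (2 * t - 1) :=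
  if_neg (not_le.2 ht.1)

theorem measurable_uncurry_concat {α β : Type*} [MeasurableSpace α] [MeasurableSpace β]
    {f g : ℝ → α → β} (hf : Measurable (Function.uncurry f))
    (hg : Measurable (Function.uncurry g)) : Measurable (Function.uncurry (concat f g)) := by
  have h : Function.uncurry (concat f g) = fun p : ℝ × α ↦ if p.1 ≤ 1 / 2 then
      Function.uncurry f (2 * p.1 - 0, p.2) else Function.uncurry g (2 * p.1 - 1, p.2) := by
    funext ⟨t, x⟩
    simp only [Function.uncurry, concat]
    split_ifs <;> rfl
  rw [h]
  exact Measurable.ite (measurableSet_le measurable_fst measurable_const)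
    (hf.comp (by fun_prop)) (hg.comp (by fun_prop))

theorem IsNarrowCurve.concat (h : IsNarrowCurve Ω ρ₀ ρ₁ ρ) (h' : IsNarrowCurve Ω ρ₁ ρ₂ ρ') :
    IsNarrowCurve Ω ρ₀ ρ₂ (concat ρ ρ') where
  continuousOn := by
    have hunion : Icc (0 : ℝ) 1 = Icc 0 (1 / 2) ∪ Icc (1 / 2) 1 :=
      (Icc_union_Icc_eq_Icc (by norm_num) (by norm_num)).symm
    rw [hunion]
    refine ContinuousOn.union_of_isClosed ?_ ?_ isClosed_Icc isClosed_Icc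
    · refine (h.continuousOn.comp (f := fun t : ℝ ↦ 2 * t - 0) (by fun_prop) fun t ht ↦
        ⟨by linarith [ht.1], by linarith [ht.2]⟩).congr fun t ht ↦ if_pos ht.2
    · refine (h'.continuousOn.comp (f := fun t : ℝ ↦ 2 * t - 1) (by fun_prop) fun t ht ↦
        ⟨by linarith [ht.1], by linarith [ht.2]⟩).congr fun t ht ↦ ?_
      rcases eq_or_lt_of_le ht.1 with rfl | hlt
      · norm_num [KFRMetric.concat, h.target, h'.source]
      · exact if_neg (not_le.2 hlt)
  onDomain t ht := by
    by_cases hle : t ≤ 1 / 2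
    · rw [KFRMetric.concat, if_pos hle]
      exact h.onDomain _ ⟨by linarith [ht.1], by linarith⟩
    · rw [KFRMetric.concat, if_neg hle]
      exact h'.onDomain _ ⟨by linarith, by linarith [ht.2]⟩
  source := by norm_num [KFRMetric.concat, h.source]
  target := by norm_num [KFRMetric.concat, h'.target]

theorem kfrAction_concat (ρ ρ' : ℝ → FiniteMeasure (Eucl d)) (v v' : ℝ → Eucl d → Eucl d)
    (r r' : ℝ → Eucl d → ℝ) :
    kfrAction (concat ρ ρ') (concat (fun t x ↦ (2 : ℝ) • v t x) fun t x ↦ (2 : ℝ) • v' t x)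
      (concat (fun t x ↦ 2 * r t x) fun t x ↦ 2 * r' t x) =
    2 * (kfrAction ρ v r + kfrAction ρ' v' r') := by
  rw [mul_add, ← lintegral_half_eq_two_mul_kfrAction _ _ _ 0,
    ← lintegral_half_eq_two_mul_kfrAction _ _ _ 1, kfrAction, restrict_Ioo_eq_add_half,
    lintegral_add_measure]
  congr 1
  · refine setLIntegral_congr_fun measurableSet_Ioo fun t ht ↦ ?_
    simp only [concat_of_mem_left _ _ ht]
  · refine setLIntegral_congr_fun measurableSet_Ioo fun t ht ↦ ?_
    simp only [concat_of_mem_right _ _ ht]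

theorem KFRAdmissible.concat (h : KFRAdmissible Ω ρ₀ ρ₁ ρ v r)
    (h' : KFRAdmissible Ω ρ₁ ρ₂ ρ' v' r') :
    KFRAdmissible Ω ρ₀ ρ₂ (concat ρ ρ')
      (concat (fun t x ↦ (2 : ℝ) • v t x) fun t x ↦ (2 : ℝ) • v' t x)
      (concat (fun t x ↦ 2 * r t x) fun t x ↦ 2 * r' t x) where
  curve := h.curve.concat h'.curve
  measurable_velocity := measurable_uncurry_concat (h.measurable_velocity.const_smul (2 : ℝ))
    (h'.measurable_velocity.const_smul (2 : ℝ))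
  measurable_reaction := measurable_uncurry_concat (h.measurable_reaction.const_mul 2)
    (h'.measurable_reaction.const_mul 2)
  finite_action := by
    rw [kfrAction_concat]
    exact ENNReal.mul_lt_top ENNReal.ofNat_lt_top
      (ENNReal.add_lt_top.2 ⟨h.finite_action, h'.finite_action⟩)
  equation φ hφ := by
    obtain ⟨hint, heq⟩ := h.integral_half 0 hφ.smooth hφ.compactSupport
    obtain ⟨hint', heq'⟩ := h'.integral_half 1 hφ.smooth hφ.compactSupport
    have hzero : ∀ t : ℝ, t ∉ Ioo (0 : ℝ) 1 → ∀ x, φ (t, x) = 0 := fun t ht x ↦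
      image_eq_zero_of_notMem_tsupport fun hmem ↦ ht (hφ.support_subset hmem).1
    rw [restrict_Ioo_eq_add_half, integral_add_measure]
    · rw [setIntegral_congr_fun measurableSet_Ioo (g := _) fun t ht ↦ ?_, heq,
        setIntegral_congr_fun measurableSet_Ioo (g := _) fun t ht ↦ ?_, heq']
      · norm_num [hzero 0, hzero 1]
      · simp only [concat_of_mem_right _ _ ht]
      · simp only [concat_of_mem_left _ _ ht]
    · refine hint.congr_fun (fun t ht ↦ ?_) measurableSet_Ioo
      simp only [concat_of_mem_left _ _ ht]
    · refine hint'.congr_fun (fun t ht ↦ ?_) measurableSet_Ioo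
      simp only [concat_of_mem_right _ _ ht]

/-- The Kantorovich-Fisher-Rao cost of joining `ρ₀` to `ρ₂` through `ρ₁`. -/
theorem KFRsq_le_two_mul_add (Ω : Set (Eucl d)) (ρ₀ ρ₁ ρ₂ : FiniteMeasure (Eucl d)) :
    KFRsq Ω ρ₀ ρ₂ ≤ 2 * (KFRsq Ω ρ₀ ρ₁ + KFRsq Ω ρ₁ ρ₂) := by
  have key : ∀ {ρ v r ρ' v' r'}, KFRAdmissible Ω ρ₀ ρ₁ ρ v r → KFRAdmissible Ω ρ₁ ρ₂ ρ' v' r' →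
      KFRsq Ω ρ₀ ρ₂ ≤ 2 * (kfrAction ρ v r + kfrAction ρ' v' r') := by
    intro _ _ _ _ _ _ h h'
    exact (h.concat h').KFRsq_le.trans_eq (kfrAction_concat _ _ _ _ _ _)
  rw [KFRsq.eq_def Ω ρ₀ ρ₁, KFRsq.eq_def Ω ρ₁ ρ₂]
  simp_rw [ENNReal.iInf_add, ENNReal.add_iInf,
    ENNReal.mul_iInf_of_ne two_ne_zero ENNReal.ofNat_ne_top]
  simp only [le_iInf_iff]
  intro ρ v r h ρ' v' r' h'
  exact key h h'

/-- Fisher-Rao paths are Kantorovich-Fisher-Rao paths with zero velocity. -/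
theorem KFRsq_le_FRsq (Ω : Set (Eucl d)) (ρ₀ ρ₁ : FiniteMeasure (Eucl d)) :
    KFRsq Ω ρ₀ ρ₁ ≤ FRsq Ω ρ₀ ρ₁ := by
  refine le_iInf fun ρ ↦ le_iInf fun r ↦ le_iInf fun h ↦ ?_
  have haction : kfrAction ρ (fun _ _ ↦ 0) r = frAction ρ r := by
    simp [kfrAction, frAction]
  have hadm : KFRAdmissible Ω ρ₀ ρ₁ ρ (fun _ _ ↦ 0) r :=
    ⟨h.curve, measurable_const, h.measurable_reaction, haction.trans_lt h.finite_action,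
      fun φ hφ ↦ by simpa using h.equation φ hφ⟩
  exact hadm.KFRsq_le.trans_eq haction

end Concatenation

section ConditionalVelocity

/-- Projection of an `L²` vector field on `α` to the functions that factor through a measure
preserving map `T : α → β`. -/
theorem exists_adjoint_of_measurePreserving {α β E : Type*} [MeasurableSpace α] [MeasurableSpace β]
    [NormedAddCommGroup E] [InnerProductSpace ℝ E] [CompleteSpace E] [MeasurableSpace E]
    [BorelSpace E] {μ : Measure α} {ν : Measure β} {T : α → β} (hT : MeasurePreserving T μ ν)
    {D : α → E} (hD : MemLp D 2 μ) :
    ∃ v : β → E, Measurable v ∧ MemLp v 2 ν ∧ ∫⁻ b, ‖v b‖ₑ ^ 2 ∂ν ≤ ∫⁻ a, ‖D a‖ₑ ^ 2 ∂μ ∧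
      ∀ w : β → E, MemLp w 2 ν → ∫ b, inner ℝ (v b) (w b) ∂ν = ∫ a, inner ℝ (D a) (w (T a)) ∂μ := by
  let A : Lp E 2 ν →L[ℝ] Lp E 2 μ := (Lp.compMeasurePreservingₗᵢ ℝ T hT).toContinuousLinearMap
  let D' : Lp E 2 μ := hD.toLp D
  let v : Lp E 2 ν := A.adjoint D'
  have hAnorm : ‖A‖ ≤ 1 := LinearIsometry.norm_toContinuousLinearMap_le _
  have hvnorm : ‖v‖ ≤ ‖D'‖ := by
    refine (A.adjoint.le_opNorm D').trans (mul_le_of_le_one_left (norm_nonneg _) ?_)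
    rwa [LinearIsometryEquiv.norm_map]
  refine ⟨v, (Lp.stronglyMeasurable v).measurable, Lp.memLp v, ?_, fun w hw ↦ ?_⟩
  · have hle : eLpNorm v 2 ν ≤ eLpNorm D 2 μ := by
      rw [Lp.norm_def, Lp.norm_def, ENNReal.toReal_le_toReal (Lp.eLpNorm_ne_top _)
        (Lp.eLpNorm_ne_top _), eLpNorm_congr_ae hD.coeFn_toLp] at hvnorm
      exact hvnorm
    have hsq := pow_le_pow_left₀ (zero_le) hle 2
    have := eLpNorm_nnreal_pow_eq_lintegral (f := v) (μ := ν) (p := 2) two_ne_zero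
    have := eLpNorm_nnreal_pow_eq_lintegral (f := D) (μ := μ) (p := 2) two_ne_zero
    simp_all
  · let w' : Lp E 2 ν := hw.toLp w
    have h1 : ∫ b, inner ℝ (v b) (w b) ∂ν = inner ℝ v w' := by
      rw [L2.inner_def]
      refine integral_congr_ae ?_
      filter_upwards [hw.coeFn_toLp] with b hb
      rw [hb]
    have h2 : ∫ a, inner ℝ (D a) (w (T a)) ∂μ = inner ℝ D' (A w') := by
      rw [L2.inner_def]
      refine integral_congr_ae ?_
      filter_upwards [hD.coeFn_toLp, Lp.coeFn_compMeasurePreserving w' hT,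
        hT.quasiMeasurePreserving.ae hw.coeFn_toLp] with a ha hb hc
      have hA : (A w') a = w (T a) := hb.trans hc
      rw [ha, hA]
    rw [h1, h2, ContinuousLinearMap.adjoint_inner_left]

end ConditionalVelocity

section DisplacementInterpolation

variable {d : ℕ}

/-- The point at time `t` on the segment from `p.1` to `p.2`. -/
noncomputable def segmentPoint (t : ℝ) (p : Eucl d × Eucl d) : Eucl d := p.1 + t • (p.2 - p.1)

theorem continuous_uncurry_segmentPoint :
    Continuous fun q : ℝ × (Eucl d × Eucl d) ↦ segmentPoint q.1 q.2 := by
  unfold segmentPoint; fun_prop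

theorem continuous_segmentPoint (t : ℝ) : Continuous (segmentPoint (d := d) t) := by
  unfold segmentPoint; fun_prop

theorem continuous_segmentPoint_left (p : Eucl d × Eucl d) :
    Continuous fun t ↦ segmentPoint t p := by
  unfold segmentPoint; fun_prop

theorem hasDerivAt_segmentPoint (t : ℝ) (p : Eucl d × Eucl d) :
    HasDerivAt (fun s ↦ segmentPoint s p) (p.2 - p.1) t := by
  unfold segmentPoint
  refine HasDerivAt.const_add _ ?_
  simpa using ((hasDerivAt_id t).smul_const (p.2 - p.1))

/-- The displacement interpolation along a transference plan. -/
noncomputable def displacementCurve (γ : FiniteMeasure (Eucl d × Eucl d)) (t : ℝ) :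
    FiniteMeasure (Eucl d) := γ.map (segmentPoint t)

theorem toMeasure_displacementCurve (γ : FiniteMeasure (Eucl d × Eucl d)) (t : ℝ) :
    (displacementCurve γ t : Measure (Eucl d)) =
      (γ : Measure (Eucl d × Eucl d)).map (segmentPoint t) := rfl

theorem continuous_displacementCurve (γ : FiniteMeasure (Eucl d × Eucl d)) :
    Continuous (displacementCurve γ) := by
  rw [FiniteMeasure.continuous_iff_forall_continuous_integral]
  intro f
  have h : ∀ t, ∫ x, f x ∂(displacementCurve γ t : Measure (Eucl d)) =
      ∫ p, f (segmentPoint t p) ∂(γ : Measure (Eucl d × Eucl d)) := fun t ↦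
    integral_map (continuous_segmentPoint t).aemeasurable f.continuous.aestronglyMeasurable
  simp_rw [h]
  refine continuous_of_dominated (bound := fun _ ↦ ‖f‖) (fun t ↦ ?_)
    (fun t ↦ Eventually.of_forall fun p ↦ f.norm_coe_le_norm _) (integrable_const _)
    (Eventually.of_forall fun p ↦ ?_)
  · exact (f.continuous.comp (continuous_segmentPoint t)).aestronglyMeasurable
  · exact f.continuous.comp (continuous_segmentPoint_left p)

variable {Ω : Set (Eucl d)} {ρ₀ ρ₁ : FiniteMeasure (Eucl d)}
  {γ : FiniteMeasure (Eucl d × Eucl d)}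

theorem onDomain_displacementCurve (hΩ : Convex ℝ Ω) (h₀ : OnDomain Ω ρ₀) (h₁ : OnDomain Ω ρ₁)
    (hγ : IsTransferencePlan ρ₀ ρ₁ γ) {t : ℝ} (ht : t ∈ Icc (0 : ℝ) 1) :
    OnDomain Ω (displacementCurve γ t) := by
  obtain ⟨K, hK, hKc, hK0⟩ := exists_isSigmaCompact_subset_measure_compl_eq_zero h₀
  obtain ⟨L, hL, hLc, hL0⟩ := exists_isSigmaCompact_subset_measure_compl_eq_zero h₁
  obtain ⟨K', hK'c, rfl⟩ := hKc
  obtain ⟨L', hL'c, rfl⟩ := hLc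
  set S : Set (Eucl d) := ⋃ m, ⋃ n, segmentPoint t '' (K' m ×ˢ L' n) with hS
  have hSmeas : MeasurableSet S := MeasurableSet.iUnion fun m ↦ MeasurableSet.iUnion fun n ↦
    (((hK'c m).prod (hL'c n)).image (continuous_segmentPoint t)).measurableSet
  have hSΩ : S ⊆ Ω := by
    simp only [hS, iUnion_subset_iff]
    rintro m n _ ⟨⟨x, y⟩, ⟨hx, hy⟩, rfl⟩
    have h := hΩ.add_smul_sub_mem (hK (mem_iUnion_of_mem m hx)) (hL (mem_iUnion_of_mem n hy)) ht
    exact h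
  refine measure_mono_null (compl_subset_compl.2 hSΩ) ?_
  rw [toMeasure_displacementCurve, Measure.map_apply (continuous_segmentPoint t).measurable
    hSmeas.compl]
  have hKmeas : MeasurableSet (⋃ m, K' m) := MeasurableSet.iUnion fun m ↦ (hK'c m).measurableSet
  have hLmeas : MeasurableSet (⋃ m, L' m) := MeasurableSet.iUnion fun m ↦ (hL'c m).measurableSet
  rw [← hγ.fst_marginal, Measure.map_apply measurable_fst hKmeas.compl] at hK0
  rw [← hγ.snd_marginal, Measure.map_apply measurable_snd hLmeas.compl] at hL0
  refine measure_mono_null (fun p hp ↦ ?_) (measure_union_null hK0 hL0)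
  by_contra hcon
  simp only [mem_union, mem_preimage, mem_compl_iff, not_or, not_not, mem_iUnion] at hcon
  obtain ⟨⟨m, hm⟩, n, hn⟩ := hcon
  exact hp (mem_iUnion_of_mem m (mem_iUnion_of_mem n ⟨p, ⟨hm, hn⟩, rfl⟩))

theorem isNarrowCurve_displacementCurve (hΩ : Convex ℝ Ω) (h₀ : OnDomain Ω ρ₀)
    (h₁ : OnDomain Ω ρ₁) (hγ : IsTransferencePlan ρ₀ ρ₁ γ) :
    IsNarrowCurve Ω ρ₀ ρ₁ (displacementCurve γ) where
  continuousOn := (continuous_displacementCurve γ).continuousOn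
  onDomain _ ht := onDomain_displacementCurve hΩ h₀ h₁ hγ ht
  source := by
    refine FiniteMeasure.toMeasure_injective ?_
    rw [toMeasure_displacementCurve, ← hγ.fst_marginal]
    congr 1
    funext p; simp [segmentPoint]
  target := by
    refine FiniteMeasure.toMeasure_injective ?_
    rw [toMeasure_displacementCurve, ← hγ.snd_marginal]
    congr 1
    funext p; simp [segmentPoint]

/-- The time-parametrised plan on `(0, 1) × (ℝ^d × ℝ^d)`. -/
noncomputable def timePlan (γ : FiniteMeasure (Eucl d × Eucl d)) :
    Measure (ℝ × (Eucl d × Eucl d)) :=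
  (volume.restrict (Ioo 0 1)).prod (γ : Measure (Eucl d × Eucl d))

instance (γ : FiniteMeasure (Eucl d × Eucl d)) : IsFiniteMeasure (timePlan γ) := by
  unfold timePlan; infer_instance

/-- The space-time position `(t, (1 - t) x + t y)`. -/
noncomputable def spaceTimePoint (q : ℝ × (Eucl d × Eucl d)) : ℝ × Eucl d :=
  (q.1, segmentPoint q.1 q.2)

theorem continuous_spaceTimePoint : Continuous (spaceTimePoint (d := d)) :=
  continuous_fst.prodMk continuous_uncurry_segmentPoint

theorem lintegral_displacementCurve (γ : FiniteMeasure (Eucl d × Eucl d))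
    {f : ℝ × Eucl d → ℝ≥0∞} (hf : Measurable f) :
    ∫⁻ t in Ioo (0 : ℝ) 1, ∫⁻ x, f (t, x) ∂(displacementCurve γ t : Measure (Eucl d)) =
      ∫⁻ z, f z ∂((timePlan γ).map spaceTimePoint) := by
  rw [lintegral_map hf continuous_spaceTimePoint.measurable, timePlan]
  refine Eq.trans ?_ (lintegral_prod _
    (hf.comp continuous_spaceTimePoint.measurable).aemeasurable).symm
  refine lintegral_congr fun t ↦ ?_
  rw [toMeasure_displacementCurve, lintegral_map (by fun_prop)
    (continuous_segmentPoint t).measurable]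
  rfl

theorem integral_displacementCurve (γ : FiniteMeasure (Eucl d × Eucl d))
    {f : ℝ × Eucl d → ℝ} (hf : Measurable f)
    (hint : Integrable f ((timePlan γ).map spaceTimePoint)) :
    ∫ t in Ioo (0 : ℝ) 1, ∫ x, f (t, x) ∂(displacementCurve γ t : Measure (Eucl d)) =
      ∫ z, f z ∂((timePlan γ).map spaceTimePoint) := by
  have hint' := hint.comp_measurable continuous_spaceTimePoint.measurable
  rw [integral_map continuous_spaceTimePoint.aemeasurable hf.aestronglyMeasurable]
  refine Eq.trans ?_ (integral_prod _ hint').symm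
  refine integral_congr_ae (Eventually.of_forall fun t ↦ ?_)
  exact integral_map (continuous_segmentPoint t).aemeasurable
    (hf.comp measurable_prodMk_left).aestronglyMeasurable

/-- The time derivative of a test function along a segment integrates to zero. -/
theorem integral_timePlan_eq_zero (γ : FiniteMeasure (Eucl d × Eucl d))
    (hmem : MemLp (fun q : ℝ × (Eucl d × Eucl d) ↦ q.2.2 - q.2.1) 2 (timePlan γ))
    {φ : ℝ × Eucl d → ℝ} (hφ : IsTestFunction φ) :
    ∫ q, timeDeriv φ (spaceTimePoint q).1 (spaceTimePoint q).2 ∂(timePlan γ) +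
      ∫ q, inner ℝ (q.2.2 - q.2.1) (spaceGrad φ (spaceTimePoint q).1 (spaceTimePoint q).2)
        ∂(timePlan γ) = 0 := by
  have hd := hφ.smooth.differentiable (by simp)
  obtain ⟨C, hC⟩ := (continuous_timeDeriv hφ.smooth).bounded_above_of_compact_support
    (hasCompactSupport_timeDeriv hφ.smooth hφ.compactSupport)
  obtain ⟨C', hC'⟩ := (continuous_spaceGrad hφ.smooth).bounded_above_of_compact_support
    (hasCompactSupport_spaceGrad hφ.smooth hφ.compactSupport)
  have hint1 : Integrable (fun q ↦ timeDeriv φ (spaceTimePoint q).1 (spaceTimePoint q).2)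
      (timePlan γ) :=
    Integrable.of_bound ((continuous_timeDeriv hφ.smooth).comp
      continuous_spaceTimePoint).aestronglyMeasurable C
      (Eventually.of_forall fun q ↦ hC (spaceTimePoint q))
  have hint2 : Integrable (fun q : ℝ × (Eucl d × Eucl d) ↦ inner ℝ (q.2.2 - q.2.1)
      (spaceGrad φ (spaceTimePoint q).1 (spaceTimePoint q).2)) (timePlan γ) :=
    integrable_inner_of_memLp hmem (MemLp.of_bound ((continuous_spaceGrad hφ.smooth).comp
      continuous_spaceTimePoint).aestronglyMeasurable C'
      (Eventually.of_forall fun q ↦ hC' (spaceTimePoint q)))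
  rw [← integral_add hint1 hint2]
  refine (integral_prod_symm _ (hint1.add hint2)).trans ?_
  refine integral_eq_zero_of_ae (Eventually.of_forall fun p ↦ ?_)
  have hzero : ∀ t : ℝ, t ∉ Ioo (0 : ℝ) 1 → ∀ x, φ (t, x) = 0 := fun t ht x ↦
    image_eq_zero_of_notMem_tsupport fun hmem ↦ ht (hφ.support_subset hmem).1
  have hderiv : ∀ t : ℝ, HasDerivAt (fun s ↦ φ (s, segmentPoint s p))
      (timeDeriv φ t (segmentPoint t p) +
        inner ℝ (p.2 - p.1) (spaceGrad φ t (segmentPoint t p))) t := by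
    intro t
    rw [timeDeriv_eq_fderiv hd, inner_spaceGrad hd, ← map_add]
    rw [Prod.mk_add_mk, add_zero, zero_add]
    exact (hd (t, segmentPoint t p)).hasFDerivAt.comp_hasDerivAt t
      ((hasDerivAt_id t).prodMk (hasDerivAt_segmentPoint t p))
  have hcont : Continuous fun t : ℝ ↦ timeDeriv φ t (segmentPoint t p) +
      inner ℝ (p.2 - p.1) (spaceGrad φ t (segmentPoint t p)) := by
    have hpt : Continuous fun t : ℝ ↦ (t, segmentPoint t p) :=
      continuous_id.prodMk (continuous_segmentPoint_left p)
    exact ((continuous_timeDeriv hφ.smooth).comp hpt).add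
      (continuous_const.inner ((continuous_spaceGrad hφ.smooth).comp hpt))
  change ∫ t in Ioo (0 : ℝ) 1, (timeDeriv φ t (segmentPoint t p) +
      inner ℝ (p.2 - p.1) (spaceGrad φ t (segmentPoint t p))) = 0
  rw [← integral_Ioc_eq_integral_Ioo, ← intervalIntegral.integral_of_le zero_le_one,
    intervalIntegral.integral_eq_sub_of_hasDerivAt (fun t _ ↦ hderiv t)
      (hcont.intervalIntegrable _ _), hzero 1 (by simp), hzero 0 (by simp), sub_zero]

theorem KFRsq_le_lintegral_of_isTransferencePlan (hΩ : Convex ℝ Ω) (h₀ : OnDomain Ω ρ₀)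
    (h₁ : OnDomain Ω ρ₁) (hγ : IsTransferencePlan ρ₀ ρ₁ γ) :
    KFRsq Ω ρ₀ ρ₁ ≤ ∫⁻ p, ‖p.1 - p.2‖ₑ ^ 2 ∂(γ : Measure (Eucl d × Eucl d)) := by
  rcases eq_or_ne (∫⁻ p, ‖p.1 - p.2‖ₑ ^ 2 ∂(γ : Measure (Eucl d × Eucl d))) ⊤ with htop | hfin
  · rw [htop]; exact le_top
  have hcost : ∫⁻ q : ℝ × (Eucl d × Eucl d), ‖q.2.2 - q.2.1‖ₑ ^ 2 ∂(timePlan γ) =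
      ∫⁻ p, ‖p.1 - p.2‖ₑ ^ 2 ∂(γ : Measure (Eucl d × Eucl d)) := by
    rw [timePlan, lintegral_prod _ (by fun_prop)]
    simp [enorm_sub_rev]
  have hmem : MemLp (fun q : ℝ × (Eucl d × Eucl d) ↦ q.2.2 - q.2.1) 2 (timePlan γ) := by
    refine ⟨Continuous.aestronglyMeasurable (by fun_prop), ?_⟩
    rw [eLpNorm_lt_top_iff_lintegral_rpow_enorm_lt_top (by simp) (by simp)]
    simpa [hcost] using hfin.lt_top
  have hT : MeasurePreserving spaceTimePoint (timePlan γ) ((timePlan γ).map spaceTimePoint) :=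
    ⟨continuous_spaceTimePoint.measurable, rfl⟩
  obtain ⟨v, hv, hvmem, hvle, hvw⟩ := exists_adjoint_of_measurePreserving hT hmem
  have haction : kfrAction (displacementCurve γ) (fun t x ↦ v (t, x)) (fun _ _ ↦ 0) ≤
      ∫⁻ p, ‖p.1 - p.2‖ₑ ^ 2 ∂(γ : Measure (Eucl d × Eucl d)) := by
    refine le_trans (le_of_eq ?_) (hvle.trans_eq hcost)
    rw [← lintegral_displacementCurve γ (hv.enorm.pow_const 2)]
    simp [kfrAction]
  have hadm : KFRAdmissible Ω ρ₀ ρ₁ (displacementCurve γ) (fun t x ↦ v (t, x)) fun _ _ ↦ 0 :=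
    { curve := isNarrowCurve_displacementCurve hΩ h₀ h₁ hγ
      measurable_velocity := hv
      measurable_reaction := measurable_const
      finite_action := haction.trans_lt hfin.lt_top
      equation := fun φ hφ ↦ by
        have hgrad : MemLp (fun z : ℝ × Eucl d ↦ spaceGrad φ z.1 z.2) 2
            ((timePlan γ).map spaceTimePoint) :=
          (continuous_spaceGrad hφ.smooth).memLp_of_hasCompactSupport
            (hasCompactSupport_spaceGrad hφ.smooth hφ.compactSupport)
        have hint1 : Integrable (fun z : ℝ × Eucl d ↦ timeDeriv φ z.1 z.2)
            ((timePlan γ).map spaceTimePoint) :=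
          (continuous_timeDeriv hφ.smooth).integrable_of_hasCompactSupport
            (hasCompactSupport_timeDeriv hφ.smooth hφ.compactSupport)
        have hint2 := integrable_inner_of_memLp hvmem hgrad
        have h := integral_displacementCurve γ
          ((continuous_timeDeriv hφ.smooth).measurable.add
            (hv.inner (continuous_spaceGrad hφ.smooth).measurable)) (hint1.add hint2)
        simp only [Pi.add_apply] at h
        simp only [zero_mul, add_zero]
        rw [h, integral_add hint1 hint2, hvw _ hgrad,
          integral_map continuous_spaceTimePoint.aemeasurable
            (continuous_timeDeriv hφ.smooth).aestronglyMeasurable]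
        exact integral_timePlan_eq_zero γ hmem hφ }
  exact hadm.KFRsq_le.trans haction

/-- The Kantorovich-Fisher-Rao cost is bounded by the Monge-Kantorovich cost. -/
theorem KFRsq_le_MKsq (hΩ : Convex ℝ Ω) (h₀ : OnDomain Ω ρ₀) (h₁ : OnDomain Ω ρ₁) :
    KFRsq Ω ρ₀ ρ₁ ≤ MKsq ρ₀ ρ₁ := by
  refine le_iInf fun γ ↦ le_iInf fun hγ ↦ ?_
  have hfin : IsFiniteMeasure γ := by
    refine ⟨?_⟩
    have h : γ univ = (ρ₀ : Measure (Eucl d)) univ := by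
      rw [← hγ.fst_marginal, Measure.map_apply measurable_fst MeasurableSet.univ, preimage_univ]
    rw [h]
    exact measure_lt_top _ _
  exact KFRsq_le_lintegral_of_isTransferencePlan (γ := ⟨γ, hfin⟩) hΩ h₀ h₁ hγ

end DisplacementInterpolation

theorem onDomain_rescaled {d : ℕ} {Ω : Set (Eucl d)} (ρ₀ : FiniteMeasure (Eucl d))
    {ρ₁ : FiniteMeasure (Eucl d)} (h₁ : OnDomain Ω ρ₁) : OnDomain Ω (rescaled ρ₀ ρ₁) := by
  have h : (ρ₁ : Measure (Eucl d)) Ωᶜ = 0 := h₁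
  simp [OnDomain, rescaled, h]

end KFRMetric

theorem mainTheorem10 {d : ℕ} (Ω : Set (KFRMetric.Eucl d)) (hΩ : Convex ℝ Ω)
    (ρ₀ ρ₁ : FiniteMeasure (KFRMetric.Eucl d))
    (h₀ : KFRMetric.OnDomain Ω ρ₀) (h₁ : KFRMetric.OnDomain Ω ρ₁) (hρ₁ : ρ₁ ≠ 0) :
    KFRMetric.KFRsq Ω ρ₀ ρ₁ ≤
      2 * (KFRMetric.MKsq ρ₀ (KFRMetric.rescaled ρ₀ ρ₁) +
        KFRMetric.FRsq Ω (KFRMetric.rescaled ρ₀ ρ₁) ρ₁) := by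
  refine (KFRMetric.KFRsq_le_two_mul_add Ω ρ₀ (KFRMetric.rescaled ρ₀ ρ₁) ρ₁).trans ?_
  gcongr
  · exact KFRMetric.KFRsq_le_MKsq hΩ h₀ (KFRMetric.onDomain_rescaled ρ₀ h₁)
  · exact KFRMetric.KFRsq_le_FRsq Ω _ _
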